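/- A \emph{continuity modulus} is a function $\gamma:(0,\infty)\to(0,\infty)$; a binary map $f$ between metric spaces is \emph{$\gamma$-continuous} if for every $\varepsilon>0$ changing one of the two arguments by less than $\gamma(\varepsilon)$ changes the value by less than $\varepsilon$. Let $G$ be a metric group (a topological group with a metric inducing its topology), and let $\mathcal F_0=(\gamma_n)_{n\in\omega}$ and $\mathcal F=(\gamma_{n,m})_{n,m\in\omega}$ be families of continuity moduli. Suppose that $G$ is an \emph{$\mathcal F_0$-continuous group} with respect to a presentation $G=\bigcup_{n\in\omega}K_n$: $K_0\subseteq K_1\subseteq\dots$ are closed subsets of finite diameter with $\{1\}\cup K_nK_n\cup K_n^{-1}\subseteq K_{n+1}$, and each multiplication map $K_n\times K_n\to K_{n+1}$ is $\gamma_n$-continuous. Regard $G$ as the many-sorted metric structure $(\{K_n\}_{n\in\omega},\cdot,{}^{-1},1)$ with operations $K_n\times K_n\to K_{n+1}$, $K_n\to K_{n+1}$. A subgroup $H\le G$ is \emph{continuously elementary} if $(\{K_n\cap H\}_{n\in\omega},\cdot,{}^{-1},1)$ is an elementary substructure of it, i.e. every formula of continuous logic takes the same value in both structures at every tuple from the substructure.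 Let $\nu:\omega\times\omega\to\omega$ be increasing (not necessarily strictly) in each argument. An action of $G$ by isometries on a real tree $T$ with a base point $0$ \emph{induces a structure from $\mathcal K_{GR}(\nu,\mathcal F)$} if, $B_m$ denoting the closed ball of radius $m$ around $0$, all $B_m$ are complete (as sorts of a metric structure), $K_n\cdot B_m\subseteq B_{\nu(n,m)}$ for all $n,m$, and each map $K_n\times B_m\to B_{\nu(n,m)}$ so obtained is $\gamma_{n,m}$-continuous. The action is \emph{$\mathcal F$-continuous} if it induces a structure from $\mathcal K_{GR}(\nu',\mathcal F)$ for some $\nu'$ increasing in each argument, and $G$ \emph{has property $\mathbf F\mathbb R$ for $\mathcal F$-continuous actions} if every $\mathcal F$-continuous isometric action of $G$ on a pointed real tree has a fixed point. For a subgroup $H\le G$ these notions refer to the presentation $H=\bigcup_n (K_n\cap H)$. \textbf{Proposition.} Suppose that $G$ has an isometric action on a pointed real tree which induces a structure from $\mathcal K_{GR}(\nu,\mathcal F)$ and has no fixed point. Then for every infinite subset $C\subseteq G$ there is a closed continuously elementary subgroup $H\le G$ that contains $C$, has the same density character (smallest cardinality of a dense subset) as $C$, and does not have property $\mathbf F\mathbb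 R$ for $\mathcal F$-continuous actions. -/

import Mathlib

open Set

universe u v

/-! ### Density character -/

/-- The density character of a topological space: the smallest cardinality of a dense subset. -/
noncomputable def densityCharacter (X : Type*) [TopologicalSpace X] : Cardinal :=
  sInf {κ : Cardinal | ∃ s : Set X, Dense s ∧ Cardinal.mk s = κ}

/-! ### Continuity moduli -/

/-- A continuity modulus: a function `γ` with `γ ε > 0` for `ε > 0`. -/
structure ContModulus where
  toFun : ℝ → ℝ
  pos : ∀ ε : ℝ, 0 < ε → 0 < toFun ε

/-- The binary map `f`, restricted to `A × B`, is uniformly continuous with modulus `γ`: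
changing one argument by less than `γ ε` changes the value by less than `ε`. -/
def HasModulusOn {X Y Z : Type*} [MetricSpace X] [MetricSpace Y] [MetricSpace Z]
    (γ : ContModulus) (f : X → Y → Z) (A : Set X) (B : Set Y) : Prop :=
  ∀ ε : ℝ, 0 < ε →
    (∀ x ∈ A, ∀ x' ∈ A, ∀ y ∈ B, dist x x' < γ.toFun ε → dist (f x y) (f x' y) < ε) ∧
    (∀ x ∈ A, ∀ y ∈ B, ∀ y' ∈ B, dist y y' < γ.toFun ε → dist (f x y) (f x y') < ε)

/-! ### Groups presented as increasing unions, and their continuous logic -/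

/-- `G = ⋃ n, K n` is an `F₀`-continuous group: the `K n` are an increasing sequence of closed
sets of finite diameter with `{1} ∪ K n * K n ∪ (K n)⁻¹ ⊆ K (n+1)`, and multiplication
`K n × K n → K (n+1)` has the continuity modulus `F₀ n`. (Inversion `K n → K (n+1)` is then
uniformly continuous as well.) -/
structure IsContinuousPresentation {G : Type*} [Group G] [MetricSpace G]
    (F₀ : ℕ → ContModulus) (K : ℕ → Set G) : Prop where
  mono : Monotone K
  iUnion_eq : ⋃ n, K n = univ
  closed : ∀ n, IsClosed (K n)
  bounded : ∀ n, Bornology.IsBounded (K n)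
  one_mem : ∀ n, (1 : G) ∈ K (n + 1)
  mul_mem : ∀ n, ∀ x ∈ K n, ∀ y ∈ K n, x * y ∈ K (n + 1)
  inv_mem : ∀ n, ∀ x ∈ K n, x⁻¹ ∈ K (n + 1)
  modulus : ∀ n, HasModulusOn (F₀ n) (fun x y : G => x * y) (K n) (K n)

/-- Terms of the many-sorted language `({K_n}, ·, ⁻¹, 1)`, with `k` free variables of sorts
`Γ 0, …, Γ (k-1)`. A term of type `GroupTerm Γ n` has values in the sort `K_n`; the operations
are `· : K_n × K_n → K_{n+1}`, `⁻¹ : K_n → K_{n+1}` and the constant `1` of sort `K_1`. -/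
inductive GroupTerm {k : ℕ} (Γ : Fin k → ℕ) : ℕ → Type
  | var (i : Fin k) : GroupTerm Γ (Γ i)
  | one : GroupTerm Γ 1
  | mul {n : ℕ} (s t : GroupTerm Γ n) : GroupTerm Γ (n + 1)
  | inv {n : ℕ} (t : GroupTerm Γ n) : GroupTerm Γ (n + 1)

/-- The value of a term at an assignment `v` of its free variables. -/
def GroupTerm.eval {G : Type*} [Group G] {k : ℕ} {Γ : Fin k → ℕ} (v : Fin k → G) :
    {n : ℕ} → GroupTerm Γ n → G
  | _, .var i => v i
  | _, .one => 1
  | _, .mul s t => s.eval v * t.eval v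
  | _, .inv t => (t.eval v)⁻¹

/-- Formulas of continuous logic in the language `({K_n}, ·, ⁻¹, 1)`. The only predicates are
the metrics of the sorts; the quantifiers `sup n` and `inf n` range over the sort `K_n` (the bound
variable is variable `0` of the body). -/
inductive GroupFormula : {k : ℕ} → (Fin k → ℕ) → Type
  | const {k : ℕ} {Γ : Fin k → ℕ} (q : ℚ) : GroupFormula Γ
  | dist {k : ℕ} {Γ : Fin k → ℕ} {n : ℕ} (s t : GroupTerm Γ n) : GroupFormula Γ
  | half {k : ℕ} {Γ : Fin k → ℕ} (φ : GroupFormula Γ) : GroupFormula Γ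
  | compl {k : ℕ} {Γ : Fin k → ℕ} (φ : GroupFormula Γ) : GroupFormula Γ
  | tsub {k : ℕ} {Γ : Fin k → ℕ} (φ ψ : GroupFormula Γ) : GroupFormula Γ
  | add {k : ℕ} {Γ : Fin k → ℕ} (φ ψ : GroupFormula Γ) : GroupFormula Γ
  | min {k : ℕ} {Γ : Fin k → ℕ} (φ ψ : GroupFormula Γ) : GroupFormula Γ
  | max {k : ℕ} {Γ : Fin k → ℕ} (φ ψ : GroupFormula Γ) : GroupFormula Γ
  | absDiff {k : ℕ} {Γ : Fin k → ℕ} (φ ψ : GroupFormula Γ) : GroupFormula Γ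
  | sup {k : ℕ} {Γ : Fin k → ℕ} (n : ℕ)
      (φ : GroupFormula (Fin.cons (α := fun _ => ℕ) n Γ)) : GroupFormula Γ
  | inf {k : ℕ} {Γ : Fin k → ℕ} (n : ℕ)
      (φ : GroupFormula (Fin.cons (α := fun _ => ℕ) n Γ)) : GroupFormula Γ

/-- The value of a formula at the assignment `v`, in the structure whose `n`-th sort is the
subset `S n` of `G`. As the sorts have different diameters, values are not truncated at `1`; the
truncated sum is `min (φ + ψ) q` for a constant `q`. -/
noncomputable def GroupFormula.eval {G : Type*} [Group G] [MetricSpace G] (S : ℕ → Set G) :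
    {k : ℕ} → {Γ : Fin k → ℕ} → GroupFormula Γ → (Fin k → G) → ℝ
  | _, _, .const q, _ => (q : ℝ)
  | _, _, .dist s t, v => Dist.dist (s.eval v) (t.eval v)
  | _, _, .half φ, v => φ.eval S v / 2
  | _, _, .compl φ, v => 1 - φ.eval S v
  | _, _, .tsub φ ψ, v => Max.max (φ.eval S v - ψ.eval S v) 0
  | _, _, .add φ ψ, v => φ.eval S v + ψ.eval S v
  | _, _, .min φ ψ, v => Min.min (φ.eval S v) (ψ.eval S v)
  | _, _, .max φ ψ, v => Max.max (φ.eval S v) (ψ.eval S v)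
  | _, _, .absDiff φ ψ, v => |φ.eval S v - ψ.eval S v|
  | _, _, .sup n φ, v => ⨆ x : S n, φ.eval S (Fin.cons (α := fun _ => G) (x : G) v)
  | _, _, .inf n φ, v => ⨅ x : S n, φ.eval S (Fin.cons (α := fun _ => G) (x : G) v)

/-- `H` is a continuously elementary subgroup of `G = ⋃ n, K n`: the substructure with sorts
`K n ∩ H` is an elementary substructure of `({K n}, ·, ⁻¹, 1)`, i.e. every formula takes the same
value in both structures at every tuple from the substructure. -/
def IsContinuouslyElementary {G : Type*} [Group G] [MetricSpace G]
    (K : ℕ → Set G) (H : Subgroup G) : Prop :=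
  ∀ (k : ℕ) (Γ : Fin k → ℕ) (φ : GroupFormula Γ) (v : Fin k → G),
    (∀ i, v i ∈ K (Γ i) ∩ (H : Set G)) →
      φ.eval (fun n => K n ∩ (H : Set G)) v = φ.eval K v

/-! ### Actions on real trees -/

/-- A real tree: a `0`-hyperbolic (four-point condition) geodesic metric space. -/
structure IsRealTree (T : Type*) [MetricSpace T] : Prop where
  geodesic : ∀ x y : T, ∃ p : ℝ → T, p 0 = x ∧ p (dist x y) = y ∧
    ∀ s ∈ Icc (0 : ℝ) (dist x y), ∀ t ∈ Icc (0 : ℝ) (dist x y), dist (p s) (p t) = |s - t|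
  hyperbolic : ∀ x y z w : T,
    dist x y + dist z w ≤ max (dist x z + dist y w) (dist x w + dist y z)

/-- A function `ν : ℕ × ℕ → ℕ` that is increasing in each argument. -/
def IncreasingInEach (ν : ℕ → ℕ → ℕ) : Prop :=
  (∀ n, Monotone (ν n)) ∧ (∀ m, Monotone fun n => ν n m)

/-- The isometric action of `G = ⋃ n, K n` on `T`, with base point `o`, induces a structure from
`K_GR(ν, F)`. The sorts on the tree side are the closed balls `B m` of radius `m` about `o`, which
are complete because metric structures are; the action restricts to maps
`K n × B m → B (ν n m)` with the continuity moduli `F n m`. -/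
structure InducesGRStructure {G : Type*} [Group G] [MetricSpace G] (K : ℕ → Set G)
    (ν : ℕ → ℕ → ℕ) (F : ℕ → ℕ → ContModulus)
    (T : Type*) [MetricSpace T] [MulAction G T] [IsIsometricSMul G T] (o : T) : Prop where
  tree : IsRealTree T
  complete : ∀ m : ℕ, IsComplete (Metric.closedBall o (m : ℝ))
  mapsTo : ∀ n m : ℕ, ∀ g ∈ K n, ∀ x ∈ Metric.closedBall o (m : ℝ),
    g • x ∈ Metric.closedBall o (ν n m : ℝ)
  modulus : ∀ n m : ℕ,
    HasModulusOn (F n m) (fun (g : G) (x : T) => g • x) (K n) (Metric.closedBall o (m : ℝ))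

/-- Property `FR` of `G = ⋃ n, K n` for `F`-continuous actions: every isometric action of `G` on a
pointed real tree which is `F`-continuous, i.e. induces a structure from `K_GR(ν, F)` for some
`ν` increasing in each argument, has a fixed point. -/
def PropertyFR {G : Type u} [Group G] [MetricSpace G] (K : ℕ → Set G)
    (F : ℕ → ℕ → ContModulus) : Prop :=
  ∀ (ν : ℕ → ℕ → ℕ), IncreasingInEach ν →
    ∀ (T : Type v) [MetricSpace T] [MulAction G T] [IsIsometricSMul G T] (o : T),
      InducesGRStructure K ν F T o → ∃ x : T, ∀ g : G, g • x = x

/-!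
The subgroup `H` is the closure of a Skolem hull, of cardinality the density character of `C`, that
contains a dense subset of `C` and a countable set `D` without a common fixed point in the tree.
The subgroup `H` then acts on the same tree without fixed points.

*The countable set `D`* (`exists_countable_forall_exists_smul_ne`). Otherwise every countable subset
of `G` has a common fixed point. Fixed point sets are closed and convex, and in a tree with complete
balls such a set has a unique point nearest to the base point `o`. The distance from `o` to the
common fixed points of `D` increases with `D`, and its supremum over countable `D` is attained,
because a countable union of countable sets is countable. For a `D` attaining it, enlarging `D` by
one element leaves the nearest point unchanged, so this point is fixed by all of `G`.

*The subgroup `H`.* The language is countable, so any set of cardinality at most an infinite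
`κ` lies in a subgroup `B` of cardinality at most `κ` that contains approximate witnesses for all
formulas with parameters in `B` and, for each of its points, approximately nearest points in each sort `K n`
(`exists_subgroup_closed_under_witnesses`). The latter makes `K n ∩ B` dense in `K n ∩ closure B`.
As multiplication and inversion are uniformly continuous on each sort, so is every formula
(`GroupFormula.uniformContinuousOn_eval`), and the Tarski–Vaught test passes from `B` to its closure
(`isContinuouslyElementary_topologicalClosure`).

*Density characters.* The closure of `B` has density character at most the cardinality of `B`, and
at least that of its subspace `C` (`Isometry.densityCharacter_le`).
-/

/-! ### Nearest points in real trees -/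

/-- In a tree the segment `[x, y]` contains the median of `o, x, y`, whose distance to `o` is the
Gromov product `(d(o,x) + d(o,y) - d(x,y)) / 2`. If `S` contains the segments between its points,
that distance is at least `d(o, S)`. -/
lemma IsRealTree.dist_le_add_sub_infDist {T : Type*} [MetricSpace T] (hT : IsRealTree T)
    {S : Set T}
    (hS : ∀ x ∈ S, ∀ y ∈ S, ∀ z, dist x z + dist z y = dist x y → z ∈ S)
    (o : T) {x y : T} (hx : x ∈ S) (hy : y ∈ S) :
    dist x y ≤ dist o x + dist o y - 2 * Metric.infDist o S := by
  obtain ⟨p, h0, h1, hp⟩ := hT.geodesic x y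
  have t1 := dist_triangle o y x
  have t2 := dist_triangle o x y
  have t3 := dist_triangle x o y
  rw [dist_comm y x] at t1
  rw [dist_comm x o] at t3
  set a := (dist x y + dist o x - dist o y) / 2 with ha
  have ha0 : 0 ≤ a := by linarith
  have ha1 : a ≤ dist x y := by linarith
  have hd0 : (0 : ℝ) ≤ dist x y := dist_nonneg
  have hxm : dist x (p a) = a := by
    have := hp 0 ⟨le_rfl, hd0⟩ a ⟨ha0, ha1⟩
    rwa [h0, zero_sub, abs_neg, abs_of_nonneg ha0] at this
  have hmy : dist (p a) y = dist x y - a := by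
    have := hp a ⟨ha0, ha1⟩ _ ⟨hd0, le_rfl⟩
    rwa [h1, abs_sub_comm, abs_of_nonneg (by linarith)] at this
  have hm : p a ∈ S := hS x hx y hy _ (by rw [hxm, hmy]; ring)
  have hinf := Metric.infDist_le_dist_of_mem (x := o) hm
  have h4 := hT.hyperbolic o (p a) x y
  rw [dist_comm (p a) x, hxm, hmy] at h4
  have : max (dist o x + (dist x y - a)) (dist o y + a)
      = (dist o x + dist o y + dist x y) / 2 := by
    rw [max_eq_left] <;> rw [ha] <;> linarith
  linarith

/-- A nonempty closed set containing the segments between its points has a point nearest to `o`: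
a minimizing sequence is Cauchy by `IsRealTree.dist_le_add_sub_infDist`. -/
lemma IsRealTree.exists_dist_eq_infDist {T : Type*} [MetricSpace T] (hT : IsRealTree T)
    {o : T} (hc : ∀ m : ℕ, IsComplete (Metric.closedBall o (m : ℝ)))
    {S : Set T} (hne : S.Nonempty) (hcl : IsClosed S)
    (hS : ∀ x ∈ S, ∀ y ∈ S, ∀ z, dist x z + dist z y = dist x y → z ∈ S) :
    ∃ p ∈ S, dist o p = Metric.infDist o S := by
  set r := Metric.infDist o S with hr
  have hex : ∀ n : ℕ, ∃ x ∈ S, dist o x < r + 1 / (n + 1 : ℝ) := fun n =>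
    (Metric.infDist_lt_iff hne).1
      (by rw [← hr]; linarith [Nat.one_div_pos_of_nat (α := ℝ) (n := n)])
  choose x hxS hx using hex
  have hx1 : ∀ n, dist o (x n) ≤ r + 1 := fun n => by
    have h : 1 / (n + 1 : ℝ) ≤ 1 := by
      rw [div_le_one (by positivity)]; linarith [(Nat.cast_nonneg n : (0 : ℝ) ≤ n)]
    linarith [hx n]
  have hcau : CauchySeq x := by
    refine cauchySeq_of_le_tendsto_0 (fun N : ℕ => 2 * (1 / (N + 1 : ℝ))) ?_ ?_
    · intro n m N hn hm
      have h := hT.dist_le_add_sub_infDist hS o (hxS n) (hxS m)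
      have h1 := Nat.one_div_le_one_div (α := ℝ) hn
      have h2 := Nat.one_div_le_one_div (α := ℝ) hm
      linarith [hx n, hx m]
    · simpa using (tendsto_one_div_add_atTop_nhds_zero_nat (𝕜 := ℝ)).const_mul 2
  obtain ⟨m, hm⟩ := exists_nat_ge (r + 1)
  obtain ⟨p, -, hp⟩ := cauchySeq_tendsto_of_isComplete (hc m)
    (fun n => by rw [Metric.mem_closedBall, dist_comm]; exact (hx1 n).trans hm) hcau
  have hpS : p ∈ S := hcl.mem_of_tendsto hp (Filter.Eventually.of_forall hxS)
  refine ⟨p, hpS, le_antisymm ?_ (Metric.infDist_le_dist_of_mem hpS)⟩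
  refine le_of_tendsto_of_tendsto' (tendsto_const_nhds.dist hp) (?_ :
    Filter.Tendsto (fun n : ℕ => r + 1 / (n + 1 : ℝ)) _ _) fun n => (hx n).le
  simpa using (tendsto_one_div_add_atTop_nhds_zero_nat (𝕜 := ℝ)).const_add r

/-- A point of a segment of a tree is determined by its distances to the endpoints, so an isometry
fixing the endpoints fixes the segment. -/
lemma IsRealTree.smul_eq_of_between {G T : Type*} [Group G] [MetricSpace T] [MulAction G T]
    [IsIsometricSMul G T] (hT : IsRealTree T) {g : G} {x y z : T} (hx : g • x = x) (hy : g • y = y)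
    (hz : dist x z + dist z y = dist x y) : g • z = z := by
  have h1 : dist x (g • z) = dist x z := by
    conv_lhs => rw [← hx]
    exact dist_smul g x z
  have h2 : dist (g • z) y = dist z y := by
    conv_lhs => rw [← hy]
    exact dist_smul g z y
  have h := hT.hyperbolic x y (g • z) z
  rw [h1, dist_comm y z, dist_comm y, h2, hz, max_self] at h
  exact dist_le_zero.1 (by linarith)

/-! ### Countable sets without a common fixed point -/

/-- Among countable subsets `D` of the group, let `D` maximize the distance from `o` to the common
fixed point set. Adding a further element does not move the nearest fixed point, which is
therefore fixed by the whole group. -/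
lemma exists_countable_forall_exists_smul_ne {G T : Type*} [Group G] [MetricSpace T]
    [MulAction G T] [IsIsometricSMul G T] (hT : IsRealTree T) {o : T}
    (hc : ∀ m : ℕ, IsComplete (Metric.closedBall o (m : ℝ)))
    (hfix : ∀ x : T, ∃ g : G, g • x ≠ x) :
    ∃ D : Set G, D.Countable ∧ ∀ x : T, ∃ g ∈ D, g • x ≠ x := by
  by_contra! hcon
  let Fx : Set G → Set T := fun D => {x | ∀ g ∈ D, g • x = x}
  have hne : ∀ D, D.Countable → (Fx D).Nonempty := hcon
  have hanti : ∀ {D E : Set G}, D ⊆ E → Fx E ⊆ Fx D := fun h x hx g hg => hx g (h hg)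
  have hcl : ∀ D, IsClosed (Fx D) := fun D => by
    simp only [Fx, ofPred_forall]
    exact isClosed_biInter fun g _ => isClosed_eq (continuous_const_smul g) continuous_id
  have hconv : ∀ D, ∀ x ∈ Fx D, ∀ y ∈ Fx D, ∀ z, dist x z + dist z y = dist x y → z ∈ Fx D :=
    fun D x hx y hy z hz g hg => hT.smul_eq_of_between (hx g hg) (hy g hg) hz
  let R : Set ENNReal := (fun D => Metric.infEDist o (Fx D)) '' {D : Set G | D.Countable}
  have hRne : R.Nonempty := ⟨_, ∅, countable_empty, rfl⟩
  -- The supremum of the distances is attained at a countable union.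
  obtain ⟨s, -, hs, hsR⟩ := exists_seq_tendsto_sSup hRne (OrderTop.bddAbove R)
  choose E hEc hE using hsR
  have hDc : (⋃ n, E n).Countable := countable_iUnion hEc
  set D := ⋃ n, E n with hD
  have hmax : ∀ D', D'.Countable → Metric.infEDist o (Fx D') ≤ Metric.infEDist o (Fx D) := by
    intro D' hD'
    refine (le_sSup (mem_image_of_mem (fun D => Metric.infEDist o (Fx D)) hD' :
      _ ∈ R)).trans (le_of_tendsto' hs fun n => ?_)
    rw [← hE n]
    exact Metric.infEDist_anti (hanti (subset_iUnion E n))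
  obtain ⟨p, hpD, hp⟩ := hT.exists_dist_eq_infDist hc (hne D hDc) (hcl D) (hconv D)
  obtain ⟨g, hg⟩ := hfix p
  have hgc : (insert g D).Countable := hDc.insert g
  obtain ⟨q, hqD, hq⟩ :=
    hT.exists_dist_eq_infDist hc (hne _ hgc) (hcl (insert g D)) (hconv _)
  have hsub : D ⊆ insert g D := subset_insert g D
  have hle : dist o q ≤ Metric.infDist o (Fx D) := by
    rw [hq]
    exact ENNReal.toReal_mono (Metric.infEDist_ne_top (hne D hDc)) (hmax _ hgc)
  have hpq : dist p q ≤ 0 := by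
    have := hT.dist_le_add_sub_infDist (hconv D) o hpD (hanti hsub hqD)
    linarith
  rw [dist_le_zero.1 hpq] at hg
  exact hg (hqD g (mem_insert g D))

/-! ### Countability of the language -/

namespace GroupTerm

/-- An injective numbering of the terms of all sorts over a fixed context. -/
def code {k : ℕ} {Γ : Fin k → ℕ} : {n : ℕ} → GroupTerm Γ n → ℕ
  | _, .var i => Nat.pair 0 i
  | _, .one => Nat.pair 1 0
  | _, .mul s t => Nat.pair 2 (Nat.pair s.code t.code)
  | _, .inv t => Nat.pair 3 t.code

/-- Sorts are compared too, so that the induction on the indexed family goes through. -/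
lemma code_inj {k : ℕ} {Γ : Fin k → ℕ} {n : ℕ} (s : GroupTerm Γ n) :
    ∀ {m : ℕ} (t : GroupTerm Γ m), s.code = t.code → n = m ∧ s ≍ t := by
  induction s with
  | var i =>
    intro m t h
    cases t <;> simp [code, Nat.pair_eq_pair, Fin.val_inj] at h
    subst h; exact ⟨rfl, HEq.rfl⟩
  | one =>
    intro m t h
    cases t <;> simp [code, Nat.pair_eq_pair] at h
    exact ⟨rfl, HEq.rfl⟩
  | mul a b iha ihb =>
    intro m t h
    cases t <;> simp [code, Nat.pair_eq_pair] at h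
    obtain ⟨rfl, h1⟩ := iha _ h.1
    obtain ⟨-, h2⟩ := ihb _ h.2
    cases h1; cases h2; exact ⟨rfl, HEq.rfl⟩
  | inv a iha =>
    intro m t h
    cases t <;> simp [code, Nat.pair_eq_pair] at h
    obtain ⟨rfl, h1⟩ := iha _ h
    cases h1; exact ⟨rfl, HEq.rfl⟩

end GroupTerm

namespace GroupFormula

/-- An injective numbering of the formulas over a fixed context. -/
def code : {k : ℕ} → {Γ : Fin k → ℕ} → GroupFormula Γ → ℕ
  | _, _, .const q => Nat.pair 0 (Encodable.encode q)
  | _, _, .dist (n := n) s t => Nat.pair 1 (Nat.pair n (Nat.pair s.code t.code))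
  | _, _, .half φ => Nat.pair 2 φ.code
  | _, _, .compl φ => Nat.pair 3 φ.code
  | _, _, .tsub φ ψ => Nat.pair 4 (Nat.pair φ.code ψ.code)
  | _, _, .add φ ψ => Nat.pair 5 (Nat.pair φ.code ψ.code)
  | _, _, .min φ ψ => Nat.pair 6 (Nat.pair φ.code ψ.code)
  | _, _, .max φ ψ => Nat.pair 7 (Nat.pair φ.code ψ.code)
  | _, _, .absDiff φ ψ => Nat.pair 8 (Nat.pair φ.code ψ.code)
  | _, _, .sup n φ => Nat.pair 9 (Nat.pair n φ.code)
  | _, _, .inf n φ => Nat.pair 10 (Nat.pair n φ.code)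

lemma code_injective {k : ℕ} {Γ : Fin k → ℕ} :
    Function.Injective (code : GroupFormula Γ → ℕ) := by
  intro φ
  induction φ with
  | const q =>
    intro ψ h
    cases ψ <;> simp [code, Nat.pair_eq_pair] at h
    rw [h]
  | dist s t =>
    intro ψ h
    cases ψ <;> simp [code, Nat.pair_eq_pair] at h
    obtain ⟨rfl, h1, h2⟩ := h
    rw [eq_of_heq (s.code_inj _ h1).2, eq_of_heq (t.code_inj _ h2).2]
  | half φ ih =>
    intro ψ h
    cases ψ <;> simp [code, Nat.pair_eq_pair] at h
    rw [ih h]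
  | compl φ ih =>
    intro ψ h
    cases ψ <;> simp [code, Nat.pair_eq_pair] at h
    rw [ih h]
  | tsub φ χ ih ih' | add φ χ ih ih' | min φ χ ih ih' | max φ χ ih ih' | absDiff φ χ ih ih' =>
    intro ψ h
    cases ψ <;> simp [code, Nat.pair_eq_pair] at h
    rw [ih h.1, ih' h.2]
  | sup n φ ih | inf n φ ih =>
    intro ψ h
    cases ψ <;> simp [code, Nat.pair_eq_pair] at h
    obtain ⟨rfl, h2⟩ := h
    rw [ih h2]

instance {k : ℕ} (Γ : Fin k → ℕ) : Countable (GroupFormula Γ) :=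
  code_injective.countable

end GroupFormula

/-! ### Boundedness and uniform continuity of formulas -/

lemma cons_mem_pi {G : Type*} {k : ℕ} {Γ : Fin k → ℕ} {S : ℕ → Set G} {n : ℕ} {x : G}
    {v : Fin k → G} (hx : x ∈ S n) (hv : v ∈ univ.pi fun i => S (Γ i)) :
    (Fin.cons (α := fun _ => G) x v) ∈
      univ.pi fun i => S (Fin.cons (α := fun _ => ℕ) n Γ i) := by
  intro i _
  refine Fin.cases ?_ (fun j => ?_) i
  · simpa using hx
  · simpa using hv j trivial

lemma dist_cons_cons_lt {G : Type*} [MetricSpace G] {k : ℕ} {x : G} {v w : Fin k → G} {δ : ℝ}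
    (hδ : 0 < δ) (h : dist v w < δ) :
    dist (Fin.cons (α := fun _ => G) x v) (Fin.cons (α := fun _ => G) x w) < δ := by
  rw [dist_pi_lt_iff hδ] at h ⊢
  intro i
  refine Fin.cases ?_ (fun j => ?_) i
  · simpa using hδ
  · simpa using h j

section Continuity

variable {G : Type*} [Group G] [MetricSpace G] {F₀ : ℕ → ContModulus} {K : ℕ → Set G}

namespace IsContinuousPresentation

lemma uniformContinuousOn_mul (hK : IsContinuousPresentation F₀ K) {α : Type*}
    [PseudoMetricSpace α] {s : Set α} {n : ℕ} {f g : α → G} (hf : UniformContinuousOn f s)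
    (hg : UniformContinuousOn g s) (hfK : MapsTo f s (K n)) (hgK : MapsTo g s (K n)) :
    UniformContinuousOn (fun x => f x * g x) s := by
  rw [Metric.uniformContinuousOn_iff] at *
  intro ε hε
  have hε2 : 0 < ε / 2 := half_pos hε
  obtain ⟨δ₁, h₁, H₁⟩ := hf _ ((F₀ n).pos _ hε2)
  obtain ⟨δ₂, h₂, H₂⟩ := hg _ ((F₀ n).pos _ hε2)
  refine ⟨min δ₁ δ₂, lt_min h₁ h₂, fun x hx y hy hxy => ?_⟩
  have e1 := (hK.modulus n _ hε2).1 _ (hfK hx) _ (hfK hy) _ (hgK hx)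
    (H₁ x hx y hy (hxy.trans_le (min_le_left _ _)))
  have e2 := (hK.modulus n _ hε2).2 _ (hfK hy) _ (hgK hx) _ (hgK hy)
    (H₂ x hx y hy (hxy.trans_le (min_le_right _ _)))
  calc _ ≤ _ := dist_triangle _ (f y * g x) _
    _ < ε := by linarith

/-- Inversion is uniformly continuous on `K n`, because `x⁻¹ = (x⁻¹ * y) * y⁻¹` and
`y⁻¹ = (x⁻¹ * x) * y⁻¹`. -/
lemma uniformContinuousOn_inv (hK : IsContinuousPresentation F₀ K) (n : ℕ) :
    UniformContinuousOn (fun x : G => x⁻¹) (K n) := by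
  rw [Metric.uniformContinuousOn_iff]
  intro ε hε
  have hγ := (F₀ (n + 2)).pos _ hε
  refine ⟨_, (F₀ (n + 1)).pos _ hγ, fun x hx y hy hxy => ?_⟩
  have hx1 := hK.mono n.le_succ hx
  have hy1 := hK.mono n.le_succ hy
  have hxi := hK.inv_mem n x hx
  have h1 := (hK.modulus (n + 1) _ hγ).2 _ hxi _ hx1 _ hy1 hxy
  have h2 := (hK.modulus (n + 2) _ hε).1 _ (hK.mul_mem _ _ hxi _ hx1) _
    (hK.mul_mem _ _ hxi _ hy1) _ (hK.mono (n + 1).le_succ (hK.inv_mem n y hy)) h1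
  rw [dist_comm]
  simpa using h2

end IsContinuousPresentation

lemma GroupTerm.eval_mem (hK : IsContinuousPresentation F₀ K) {k : ℕ} {Γ : Fin k → ℕ} {n : ℕ}
    (t : GroupTerm Γ n) {v : Fin k → G} (hv : v ∈ univ.pi fun i => K (Γ i)) : t.eval v ∈ K n := by
  induction t with
  | var i => exact hv i trivial
  | one => exact hK.one_mem 0
  | mul s t hs ht => exact hK.mul_mem _ _ hs _ ht
  | inv t ht => exact hK.inv_mem _ _ ht

lemma GroupTerm.uniformContinuousOn_eval (hK : IsContinuousPresentation F₀ K) {k : ℕ}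
    {Γ : Fin k → ℕ} {n : ℕ} (t : GroupTerm Γ n) :
    UniformContinuousOn (fun v : Fin k → G => t.eval v) (univ.pi fun i => K (Γ i)) := by
  induction t with
  | var i => exact (Pi.uniformContinuous_proj (fun _ => G) i).uniformContinuousOn
  | one => exact uniformContinuous_const.uniformContinuousOn
  | mul s t hs ht =>
    exact hK.uniformContinuousOn_mul hs ht (fun v hv => s.eval_mem hK hv)
      (fun v hv => t.eval_mem hK hv)
  | inv t ht =>
    exact (hK.uniformContinuousOn_inv _).comp ht (fun v hv => t.eval_mem hK hv)

/-- A quantifier over a bounded family is never a junk supremum or infimum: an empty sort gives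
the value `0`, which obeys the same bound. -/
lemma GroupFormula.exists_abs_eval_le (hK : IsContinuousPresentation F₀ K) {k : ℕ}
    {Γ : Fin k → ℕ} (φ : GroupFormula Γ) :
    ∃ M : ℝ, 0 ≤ M ∧ ∀ v ∈ univ.pi fun i => K (Γ i), |φ.eval K v| ≤ M := by
  induction φ with
  | const q => exact ⟨|(q : ℝ)|, abs_nonneg _, fun v _ => le_rfl⟩
  | @dist k Γ n s t =>
    obtain ⟨M, hM⟩ := Metric.isBounded_iff.1 (hK.bounded n)
    refine ⟨Max.max M 0, le_max_right _ _, fun v hv => ?_⟩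
    rw [GroupFormula.eval, abs_of_nonneg dist_nonneg]
    exact (hM (s.eval_mem hK hv) (t.eval_mem hK hv)).trans (le_max_left _ _)
  | half φ ih =>
    obtain ⟨M, h0, hM⟩ := ih
    refine ⟨M, h0, fun v hv => ?_⟩
    have := hM v hv
    rw [abs_le] at this ⊢
    constructor <;> simp only [GroupFormula.eval] <;> linarith
  | compl φ ih =>
    obtain ⟨M, h0, hM⟩ := ih
    refine ⟨1 + M, by linarith, fun v hv => ?_⟩
    have := hM v hv
    rw [abs_le] at this ⊢
    constructor <;> simp only [GroupFormula.eval] <;> linarith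
  | tsub φ ψ ih ih' | add φ ψ ih ih' | min φ ψ ih ih' | max φ ψ ih ih' | absDiff φ ψ ih ih' =>
    obtain ⟨M, h0, hM⟩ := ih
    obtain ⟨M', h0', hM'⟩ := ih'
    refine ⟨M + M', by linarith, fun v hv => ?_⟩
    have := hM v hv
    have := hM' v hv
    simp only [GroupFormula.eval]
    grind
  | @sup k Γ n φ ih =>
    obtain ⟨M, h0, hM⟩ := ih
    refine ⟨M, h0, fun v hv => ?_⟩
    simp only [GroupFormula.eval]
    have h : ∀ x : K n, |φ.eval K (Fin.cons (α := fun _ => G) (x : G) v)| ≤ M :=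
      fun x => hM _ (cons_mem_pi x.2 hv)
    rcases isEmpty_or_nonempty (K n) with hE | ⟨⟨x⟩⟩
    · simpa [Real.iSup_of_isEmpty] using h0
    · have hb : BddAbove (range fun x : K n => φ.eval K (Fin.cons (α := fun _ => G) (x : G) v)) :=
        ⟨M, by rintro _ ⟨x, rfl⟩; exact (abs_le.1 (h x)).2⟩
      have : Nonempty (K n) := ⟨x⟩
      exact abs_le.2 ⟨(abs_le.1 (h x)).1.trans (le_ciSup hb x),
        ciSup_le fun x => (abs_le.1 (h x)).2⟩
  | @inf k Γ n φ ih =>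
    obtain ⟨M, h0, hM⟩ := ih
    refine ⟨M, h0, fun v hv => ?_⟩
    simp only [GroupFormula.eval]
    have h : ∀ x : K n, |φ.eval K (Fin.cons (α := fun _ => G) (x : G) v)| ≤ M :=
      fun x => hM _ (cons_mem_pi x.2 hv)
    rcases isEmpty_or_nonempty (K n) with hE | ⟨⟨x⟩⟩
    · simpa [Real.iInf_of_isEmpty] using h0
    · have hb : BddBelow (range fun x : K n => φ.eval K (Fin.cons (α := fun _ => G) (x : G) v)) :=
        ⟨-M, by rintro _ ⟨x, rfl⟩; exact (abs_le.1 (h x)).1⟩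
      have : Nonempty (K n) := ⟨x⟩
      exact abs_le.2 ⟨le_ciInf fun x => (abs_le.1 (h x)).1,
        (ciInf_le hb x).trans (abs_le.1 (h x)).2⟩

lemma abs_ciInf_sub_ciInf_le {ι : Type*} [Nonempty ι] {f g : ι → ℝ} {ε : ℝ}
    (hf : BddBelow (range f)) (hg : BddBelow (range g)) (h : ∀ i, |f i - g i| ≤ ε) :
    |(⨅ i, f i) - ⨅ i, g i| ≤ ε := by
  have h1 : (⨅ i, g i) - ε ≤ ⨅ i, f i := le_ciInf fun i => by
    linarith [ciInf_le hg i, (abs_le.1 (h i)).1]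
  have h2 : (⨅ i, f i) - ε ≤ ⨅ i, g i := le_ciInf fun i => by
    linarith [ciInf_le hf i, (abs_le.1 (h i)).2]
  rw [abs_le]; constructor <;> linarith

lemma abs_ciSup_sub_ciSup_le {ι : Type*} [Nonempty ι] {f g : ι → ℝ} {ε : ℝ}
    (hf : BddAbove (range f)) (hg : BddAbove (range g)) (h : ∀ i, |f i - g i| ≤ ε) :
    |(⨆ i, f i) - ⨆ i, g i| ≤ ε := by
  have h1 : (⨆ i, f i) ≤ (⨆ i, g i) + ε := ciSup_le fun i => by
    linarith [le_ciSup hg i, (abs_le.1 (h i)).2]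
  have h2 : (⨆ i, g i) ≤ (⨆ i, f i) + ε := ciSup_le fun i => by
    linarith [le_ciSup hf i, (abs_le.1 (h i)).1]
  rw [abs_le]; constructor <;> linarith

lemma GroupFormula.bddAbove_range_eval (hK : IsContinuousPresentation F₀ K) {k : ℕ}
    {Γ : Fin k → ℕ} {n : ℕ} (φ : GroupFormula (Fin.cons (α := fun _ => ℕ) n Γ)) {v : Fin k → G}
    (hv : v ∈ univ.pi fun i => K (Γ i)) {A : Set G} (hA : A ⊆ K n) :
    BddAbove (range fun x : A => φ.eval K (Fin.cons (α := fun _ => G) (x : G) v)) := by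
  obtain ⟨M, -, hM⟩ := φ.exists_abs_eval_le hK
  exact ⟨M, by rintro _ ⟨x, rfl⟩; exact (abs_le.1 (hM _ (cons_mem_pi (hA x.2) hv))).2⟩

lemma GroupFormula.bddBelow_range_eval (hK : IsContinuousPresentation F₀ K) {k : ℕ}
    {Γ : Fin k → ℕ} {n : ℕ} (φ : GroupFormula (Fin.cons (α := fun _ => ℕ) n Γ)) {v : Fin k → G}
    (hv : v ∈ univ.pi fun i => K (Γ i)) {A : Set G} (hA : A ⊆ K n) :
    BddBelow (range fun x : A => φ.eval K (Fin.cons (α := fun _ => G) (x : G) v)) := by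
  obtain ⟨M, -, hM⟩ := φ.exists_abs_eval_le hK
  exact ⟨-M, by rintro _ ⟨x, rfl⟩; exact (abs_le.1 (hM _ (cons_mem_pi (hA x.2) hv))).1⟩

lemma uniformContinuousOn_of_abs_sub_le {α : Type*} [PseudoMetricSpace α] {s : Set α}
    {f g h : α → ℝ} (hf : UniformContinuousOn f s) (hg : UniformContinuousOn g s)
    (H : ∀ x y, |h x - h y| ≤ |f x - f y| + |g x - g y|) : UniformContinuousOn h s := by
  rw [Metric.uniformContinuousOn_iff] at *
  intro ε hε
  obtain ⟨δ₁, h₁, H₁⟩ := hf _ (half_pos hε)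
  obtain ⟨δ₂, h₂, H₂⟩ := hg _ (half_pos hε)
  refine ⟨min δ₁ δ₂, lt_min h₁ h₂, fun x hx y hy hxy => ?_⟩
  have e1 := H₁ x hx y hy (hxy.trans_le (min_le_left _ _))
  have e2 := H₂ x hx y hy (hxy.trans_le (min_le_right _ _))
  rw [Real.dist_eq] at *
  linarith [H x y]

lemma GroupFormula.uniformContinuousOn_eval (hK : IsContinuousPresentation F₀ K) {k : ℕ}
    {Γ : Fin k → ℕ} (φ : GroupFormula Γ) :
    UniformContinuousOn (φ.eval K) (univ.pi fun i => K (Γ i)) := by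
  induction φ with
  | const q => exact uniformContinuous_const.uniformContinuousOn
  | dist s t =>
    have hs := s.uniformContinuousOn_eval hK
    have ht := t.uniformContinuousOn_eval hK
    rw [uniformContinuousOn_iff_restrict] at hs ht ⊢
    exact uniformContinuous_dist.comp (hs.prodMk ht)
  | half φ ih =>
    refine uniformContinuousOn_of_abs_sub_le ih ih fun x y => ?_
    simp only [GroupFormula.eval]
    grind
  | compl φ ih =>
    refine uniformContinuousOn_of_abs_sub_le ih ih fun x y => ?_
    simp only [GroupFormula.eval]
    grind
  | tsub φ ψ ih ih' | add φ ψ ih ih' | min φ ψ ih ih' | max φ ψ ih ih' | absDiff φ ψ ih ih' =>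
    refine uniformContinuousOn_of_abs_sub_le ih ih' fun x y => ?_
    simp only [GroupFormula.eval]
    grind
  | @sup k Γ n φ ih =>
    rw [Metric.uniformContinuousOn_iff] at *
    intro ε hε
    obtain ⟨δ, hδ, H⟩ := ih _ (half_pos hε)
    refine ⟨δ, hδ, fun v hv w hw hvw => ?_⟩
    simp only [GroupFormula.eval, Real.dist_eq]
    rcases isEmpty_or_nonempty (K n) with hE | hE
    · simpa [Real.iSup_of_isEmpty] using hε
    · refine (abs_ciSup_sub_ciSup_le (φ.bddAbove_range_eval hK hv subset_rfl)
        (φ.bddAbove_range_eval hK hw subset_rfl) fun x => ?_).trans_lt (half_lt_self hε)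
      exact (H _ (cons_mem_pi x.2 hv) _ (cons_mem_pi x.2 hw) (dist_cons_cons_lt hδ hvw)).le
  | @inf k Γ n φ ih =>
    rw [Metric.uniformContinuousOn_iff] at *
    intro ε hε
    obtain ⟨δ, hδ, H⟩ := ih _ (half_pos hε)
    refine ⟨δ, hδ, fun v hv w hw hvw => ?_⟩
    simp only [GroupFormula.eval, Real.dist_eq]
    rcases isEmpty_or_nonempty (K n) with hE | hE
    · simpa [Real.iInf_of_isEmpty] using hε
    · refine (abs_ciInf_sub_ciInf_le (φ.bddBelow_range_eval hK hv subset_rfl)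
        (φ.bddBelow_range_eval hK hw subset_rfl) fun x => ?_).trans_lt (half_lt_self hε)
      exact (H _ (cons_mem_pi x.2 hv) _ (cons_mem_pi x.2 hw) (dist_cons_cons_lt hδ hvw)).le

end Continuity

/-! ### Density character of metric spaces -/

lemma densityCharacter_le_mk {X : Type*} [TopologicalSpace X] {s : Set X} (hs : Dense s) :
    densityCharacter X ≤ Cardinal.mk s :=
  csInf_le' ⟨s, hs, rfl⟩

lemma exists_dense_mk_eq_densityCharacter (X : Type*) [TopologicalSpace X] :
    ∃ s : Set X, Dense s ∧ Cardinal.mk s = densityCharacter X :=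
  csInf_mem (s := {κ : Cardinal | ∃ s : Set X, Dense s ∧ Cardinal.mk s = κ})
    ⟨_, univ, dense_univ, rfl⟩

lemma aleph0_le_densityCharacter (X : Type*) [TopologicalSpace X] [T1Space X] [Infinite X] :
    Cardinal.aleph0 ≤ densityCharacter X := by
  obtain ⟨s, hs, hX⟩ := exists_dense_mk_eq_densityCharacter X
  rw [← hX, Cardinal.aleph0_le_mk_iff, infinite_coe_iff]
  intro hfin
  have := hs.closure_eq
  rw [hfin.isClosed.closure_eq] at this
  exact infinite_univ (this ▸ hfin)

/-- Density character does not increase on passing to subspaces of a metric space: given a dense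
`S`, pick a point of the subspace within `1 / (n + 1)` of `s` for every `s ∈ S` and `n` for which
there is one. -/
lemma Isometry.densityCharacter_le {X Y : Type u} [MetricSpace X] [MetricSpace Y] {f : X → Y}
    (hf : Isometry f) (hY : Cardinal.aleph0 ≤ densityCharacter Y) :
    densityCharacter X ≤ densityCharacter Y := by
  obtain ⟨S, hS, hSY⟩ := exists_dense_mk_eq_densityCharacter Y
  let I := {p : S × ℕ // ∃ x, dist (f x) p.1 < 1 / (p.2 + 1 : ℝ)}
  let c : I → X := fun p => p.2.choose
  have hc : ∀ p : I, dist (f (c p)) p.1.1 < 1 / (p.1.2 + 1 : ℝ) := fun p => p.2.choose_spec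
  have hd : Dense (range c) := by
    rw [Metric.dense_iff]
    intro x r hr
    obtain ⟨n, hn⟩ := exists_nat_one_div_lt (half_pos hr)
    obtain ⟨s, hsS, hs⟩ := hS.exists_dist_lt (f x) (Nat.one_div_pos_of_nat (α := ℝ) (n := n))
    let p : I := ⟨(⟨s, hsS⟩, n), x, hs⟩
    refine ⟨c p, ?_, p, rfl⟩
    rw [Metric.mem_ball, ← hf.dist_eq]
    have h1 : dist (f (c p)) s < 1 / (n + 1 : ℝ) := hc p
    have h2 := dist_triangle_right (f (c p)) (f x) s
    linarith
  calc densityCharacter X ≤ Cardinal.mk (range c) := densityCharacter_le_mk hd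
    _ ≤ Cardinal.mk I := Cardinal.mk_range_le
    _ ≤ Cardinal.mk (S × ℕ) := Cardinal.mk_subtype_le _
    _ = densityCharacter Y := by
      rw [Cardinal.mk_prod, hSY, Cardinal.lift_uzero, Cardinal.mk_nat, Cardinal.lift_aleph0]
      exact Cardinal.mul_aleph0_eq hY

/-! ### Skolem hulls -/

/-- A set closed under witnesses of countably many finitary relations: the substructure generated
by `A` in the language of the Skolem functions of the relations. -/
lemma exists_superset_closed_under_witnesses {X : Type u} [Nonempty X]
    {R : Set (Σ k : ℕ, (Fin k → X) → X → Prop)} (hR : R.Countable) (A : Set X)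
    {κ : Cardinal.{u}} (hκ : Cardinal.aleph0 ≤ κ) (hA : Cardinal.mk A ≤ κ) :
    ∃ B : Set X, A ⊆ B ∧ Cardinal.mk B ≤ κ ∧
      ∀ r ∈ R, ∀ v : Fin r.1 → X, (∀ j, v j ∈ B) → (∃ y, r.2 v y) → ∃ y ∈ B, r.2 v y := by
  let L : FirstOrder.Language.{u, 0} := ⟨fun k => {r : R // r.1.1 = k}, fun _ => Empty⟩
  let _ : L.Structure X :=
    { funMap := fun {k} r v => Classical.epsilon (r.1.1.2 (v ∘ Fin.cast r.2))
      RelMap := fun r => r.elim }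
  let B := FirstOrder.Language.Substructure.closure L A
  refine ⟨B, FirstOrder.Language.Substructure.subset_closure, ?_, fun r hr v hv hy => ?_⟩
  · have h := FirstOrder.Language.Substructure.lift_card_closure_le (L := L) (s := A)
    rw [Cardinal.lift_id, Cardinal.lift_id, Cardinal.lift_id] at h
    have hF : Cardinal.mk (Σ k, L.Functions k) ≤ Cardinal.aleph0 := by
      have : Countable R := hR
      have : ∀ k, Countable (L.Functions k) := fun k =>
        inferInstanceAs (Countable {r : R // r.1.1 = k})
      exact Cardinal.mk_le_aleph0
    exact h.trans (max_le hκ (Cardinal.add_le_of_le hκ hA (hF.trans hκ)))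
  · let r' : L.Functions r.1 := ⟨⟨r, hr⟩, rfl⟩
    exact ⟨_, B.fun_mem r' v hv, Classical.epsilon_spec hy⟩

/-- The Skolem hull of `A` in the structure `(K n)`, with two additions: it is a subgroup, and it
contains near-optimal approximations in `K n` of each of its points. Rational thresholds keep the
number of relations countable. -/
lemma exists_subgroup_closed_under_witnesses {G : Type u} [Group G] [MetricSpace G]
    (K : ℕ → Set G) (A : Set G) {κ : Cardinal.{u}} (hκ : Cardinal.aleph0 ≤ κ)
    (hA : Cardinal.mk A ≤ κ) :
    ∃ B : Subgroup G, A ⊆ B ∧ Cardinal.mk B ≤ κ ∧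
      (∀ (n : ℕ) (q : ℚ), ∀ x ∈ B, (∃ y ∈ K n, dist x y < q) → ∃ y ∈ K n, y ∈ B ∧ dist x y < q) ∧
      ∀ (k : ℕ) (Γ : Fin k → ℕ) (n : ℕ) (φ : GroupFormula (Fin.cons (α := fun _ => ℕ) n Γ))
        (q : ℚ) (v : Fin k → G), (∀ i, v i ∈ B) →
        (∃ y ∈ K n, φ.eval K (Fin.cons (α := fun _ => G) y v) < q) →
        ∃ y ∈ K n, y ∈ B ∧ φ.eval K (Fin.cons (α := fun _ => G) y v) < q := by
  let rDist : ℕ × ℚ → Σ k : ℕ, (Fin k → G) → G → Prop := fun p =>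
    ⟨1, fun v y => y ∈ K p.1 ∧ dist (v 0) y < p.2⟩
  let rForm : (Σ (k : ℕ) (Γ : Fin k → ℕ) (n : ℕ),
      GroupFormula (Fin.cons (α := fun _ => ℕ) n Γ) × ℚ) →
      Σ k : ℕ, (Fin k → G) → G → Prop := fun p =>
    ⟨p.1, fun v y => y ∈ K p.2.2.1 ∧
      p.2.2.2.1.eval K (Fin.cons (α := fun _ => G) y v) < p.2.2.2.2⟩
  let rOne : Σ k : ℕ, (Fin k → G) → G → Prop := ⟨0, fun _ y => y = 1⟩
  let rDiv : Σ k : ℕ, (Fin k → G) → G → Prop := ⟨2, fun v y => y = v 0 * (v 1)⁻¹⟩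
  have hR : (range rDist ∪ range rForm ∪ {rOne, rDiv}).Countable :=
    ((countable_range _).union (countable_range _)).union ((countable_singleton _).insert _)
  obtain ⟨B, hAB, hB, hw⟩ := exists_superset_closed_under_witnesses hR A hκ hA
  have h1 : (1 : G) ∈ B := by
    obtain ⟨y, hy, rfl⟩ := hw rOne (Or.inr (Or.inl rfl)) Fin.elim0 (fun j => j.elim0) ⟨1, rfl⟩
    exact hy
  have hdiv : ∀ x ∈ B, ∀ y ∈ B, x * y⁻¹ ∈ B := fun x hx y hy => by
    obtain ⟨z, hz, rfl⟩ := hw rDiv (Or.inr (Or.inr rfl)) ![x, y]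
      (by intro j; fin_cases j <;> assumption) ⟨_, rfl⟩
    exact hz
  refine ⟨Subgroup.ofDiv B ⟨1, h1⟩ hdiv, hAB, hB, fun n q x hx ⟨y, hyK, hy⟩ => ?_,
    fun k Γ n φ q v hv ⟨y, hyK, hy⟩ => ?_⟩
  · obtain ⟨z, hz, hzK, h⟩ := hw (rDist (n, q)) (Or.inl (Or.inl ⟨_, rfl⟩)) ![x]
      (by intro j; fin_cases j; exact hx) ⟨y, hyK, hy⟩
    exact ⟨z, hzK, hz, h⟩
  · obtain ⟨z, hz, hzK, h⟩ := hw (rForm ⟨k, Γ, n, φ, q⟩) (Or.inl (Or.inr ⟨_, rfl⟩)) v hv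
      ⟨y, hyK, hy⟩
    exact ⟨z, hzK, hz, h⟩

/-! ### The Tarski–Vaught test for the closure of a Skolem hull -/

lemma ciInf_subtype_eq_of_forall_exists_lt {X : Type*} {A B : Set X} (hAB : A ⊆ B) {f : X → ℝ}
    (hb : BddBelow (range fun x : B => f x))
    (h : ∀ x ∈ B, ∀ ε > 0, ∃ y ∈ A, f y < f x + ε) : ⨅ x : A, f x = ⨅ x : B, f x := by
  rcases isEmpty_or_nonempty B with hB | ⟨⟨x₀⟩⟩
  · have : IsEmpty A := ⟨fun x => hB.elim ⟨x, hAB x.2⟩⟩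
    rw [Real.iInf_of_isEmpty, Real.iInf_of_isEmpty]
  · obtain ⟨y₀, hy₀, -⟩ := h x₀ x₀.2 1 one_pos
    have : Nonempty A := ⟨⟨y₀, hy₀⟩⟩
    have : Nonempty B := ⟨x₀⟩
    have hbA : BddBelow (range fun x : A => f x) :=
      hb.mono (by rintro _ ⟨x, rfl⟩; exact ⟨⟨x, hAB x.2⟩, rfl⟩)
    refine le_antisymm (le_ciInf fun x => le_of_forall_pos_le_add fun ε hε => ?_)
      (le_ciInf fun x => ciInf_le hb ⟨x, hAB x.2⟩)
    obtain ⟨y, hy, hyx⟩ := h x x.2 ε hε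
    exact (ciInf_le hbA ⟨y, hy⟩).trans hyx.le

lemma ciSup_subtype_eq_of_forall_exists_lt {X : Type*} {A B : Set X} (hAB : A ⊆ B) {f : X → ℝ}
    (hb : BddAbove (range fun x : B => f x))
    (h : ∀ x ∈ B, ∀ ε > 0, ∃ y ∈ A, f x < f y + ε) : ⨆ x : A, f x = ⨆ x : B, f x := by
  rcases isEmpty_or_nonempty B with hB | ⟨⟨x₀⟩⟩
  · have : IsEmpty A := ⟨fun x => hB.elim ⟨x, hAB x.2⟩⟩
    rw [Real.iSup_of_isEmpty, Real.iSup_of_isEmpty]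
  · obtain ⟨y₀, hy₀, -⟩ := h x₀ x₀.2 1 one_pos
    have : Nonempty A := ⟨⟨y₀, hy₀⟩⟩
    have : Nonempty B := ⟨x₀⟩
    have hbA : BddAbove (range fun x : A => f x) :=
      hb.mono (by rintro _ ⟨x, rfl⟩; exact ⟨⟨x, hAB x.2⟩, rfl⟩)
    refine le_antisymm (ciSup_le fun x => le_ciSup hb ⟨x, hAB x.2⟩)
      (ciSup_le fun x => le_of_forall_pos_le_add fun ε hε => ?_)
    obtain ⟨y, hy, hyx⟩ := h x x.2 ε hε
    exact hyx.le.trans (add_le_add_left (le_ciSup hbA ⟨y, hy⟩) ε)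

/-- The sorts need not be open, so a point of `K n` in the closure of `B` is not a limit of points
of `K n ∩ B` for topological reasons; the nearest-point witnesses in `B` make it one. -/
lemma exists_mem_dist_lt_of_mem_closure {G : Type*} [MetricSpace G] {K : ℕ → Set G} {B : Set G}
    (hnear : ∀ (n : ℕ) (q : ℚ), ∀ x ∈ B, (∃ y ∈ K n, dist x y < q) →
      ∃ y ∈ K n, y ∈ B ∧ dist x y < q)
    {n : ℕ} {x : G} (hxK : x ∈ K n) (hxB : x ∈ closure B) {ε : ℝ} (hε : 0 < ε) :
    ∃ y ∈ K n, y ∈ B ∧ dist x y < ε := by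
  obtain ⟨q, hq0, hqε⟩ := exists_rat_btwn (half_pos hε)
  obtain ⟨b, hb, hxb⟩ := Metric.mem_closure_iff.1 hxB q hq0
  obtain ⟨y, hyK, hyB, hby⟩ := hnear n q b hb ⟨x, hxK, by rwa [dist_comm]⟩
  exact ⟨y, hyK, hyB, by linarith [dist_triangle x b y]⟩

/-- Formulas are uniformly continuous and `B` is dense in `B.topologicalClosure` sort by sort, so
approximate witnesses in `B` for parameters from `B` suffice for the Tarski–Vaught test with
parameters from the closure. -/
lemma isContinuouslyElementary_topologicalClosure {G : Type*} [Group G] [MetricSpace G]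
    [IsTopologicalGroup G] {F₀ : ℕ → ContModulus} {K : ℕ → Set G}
    (hK : IsContinuousPresentation F₀ K) {B : Subgroup G}
    (hnear : ∀ (n : ℕ) (q : ℚ), ∀ x ∈ B, (∃ y ∈ K n, dist x y < q) →
      ∃ y ∈ K n, y ∈ B ∧ dist x y < q)
    (hform : ∀ (k : ℕ) (Γ : Fin k → ℕ) (n : ℕ)
      (φ : GroupFormula (Fin.cons (α := fun _ => ℕ) n Γ)) (q : ℚ) (v : Fin k → G),
      (∀ i, v i ∈ B) → (∃ y ∈ K n, φ.eval K (Fin.cons (α := fun _ => G) y v) < q) →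
        ∃ y ∈ K n, y ∈ B ∧ φ.eval K (Fin.cons (α := fun _ => G) y v) < q) :
    IsContinuouslyElementary K B.topologicalClosure := by
  set H := B.topologicalClosure with hH
  -- Move the parameters into `B`, take a witness there, and move the parameters back.
  have key : ∀ {k : ℕ} {Γ : Fin k → ℕ} {n : ℕ}
      (φ : GroupFormula (Fin.cons (α := fun _ => ℕ) n Γ)) {v : Fin k → G},
      (∀ i, v i ∈ K (Γ i) ∩ (H : Set G)) → ∀ x ∈ K n, ∀ ε > 0, ∃ y ∈ K n ∩ (H : Set G),
        φ.eval K (Fin.cons (α := fun _ => G) y v) <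
          φ.eval K (Fin.cons (α := fun _ => G) x v) + ε := by
    intro k Γ n φ v hv x hx ε hε
    have hε3 : 0 < ε / 3 := by positivity
    obtain ⟨δ, hδ, huc⟩ := Metric.uniformContinuousOn_iff.1 (φ.uniformContinuousOn_eval hK) _ hε3
    choose w hwK hwB hvw using fun i =>
      exists_mem_dist_lt_of_mem_closure hnear (hv i).1 (hv i).2 hδ
    have hd : dist v w < δ := (dist_pi_lt_iff hδ).2 hvw
    have hvK : v ∈ univ.pi fun i => K (Γ i) := fun i _ => (hv i).1
    have hwK' : w ∈ univ.pi fun i => K (Γ i) := fun i _ => hwK i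
    have huc' : ∀ z ∈ K n, |φ.eval K (Fin.cons (α := fun _ => G) z v) -
        φ.eval K (Fin.cons (α := fun _ => G) z w)| < ε / 3 := fun z hz =>
      huc _ (cons_mem_pi hz hvK) _ (cons_mem_pi hz hwK') (dist_cons_cons_lt hδ hd)
    obtain ⟨q, hq1, hq2⟩ := exists_rat_btwn
      (lt_add_of_pos_right (φ.eval K (Fin.cons (α := fun _ => G) x w)) hε3)
    obtain ⟨y, hyK, hyB, hy⟩ := hform k Γ n φ q w hwB ⟨x, hx, hq1⟩
    refine ⟨y, ⟨hyK, B.le_topologicalClosure hyB⟩, ?_⟩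
    have h1 := abs_lt.1 (huc' x hx)
    have h2 := abs_lt.1 (huc' y hyK)
    linarith [h1.1, h2.2]
  intro k Γ φ
  induction φ with
  | const q => intro v _; rfl
  | dist s t => intro v _; rfl
  | half φ ih | compl φ ih =>
    intro v hv
    simp only [GroupFormula.eval, ih v hv]
  | tsub φ ψ ih ih' | add φ ψ ih ih' | min φ ψ ih ih' | max φ ψ ih ih' | absDiff φ ψ ih ih' =>
    intro v hv
    simp only [GroupFormula.eval, ih v hv, ih' v hv]
  | @sup k Γ n φ ih =>
    intro v hv
    have hvK : v ∈ univ.pi fun i => K (Γ i) := fun i _ => (hv i).1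
    have hsub : ∀ x : ↥(K n ∩ (H : Set G)),
        φ.eval (fun n => K n ∩ (H : Set G)) (Fin.cons (α := fun _ => G) (x : G) v) =
          φ.eval K (Fin.cons (α := fun _ => G) (x : G) v) := fun x =>
      ih _ fun i => cons_mem_pi (S := fun n => K n ∩ (H : Set G)) x.2 (fun j _ => hv j) i trivial
    simp only [GroupFormula.eval, hsub]
    refine ciSup_subtype_eq_of_forall_exists_lt inter_subset_left
      (f := fun x => φ.eval K (Fin.cons (α := fun _ => G) x v))
      (φ.bddAbove_range_eval hK hvK subset_rfl) fun x hx ε hε => ?_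
    -- Approximating a supremum of `φ` is approximating an infimum of `1 - φ`.
    obtain ⟨y, hy, h⟩ := key φ.compl hv x hx ε hε
    simp only [GroupFormula.eval] at h
    exact ⟨y, hy, by linarith⟩
  | @inf k Γ n φ ih =>
    intro v hv
    have hvK : v ∈ univ.pi fun i => K (Γ i) := fun i _ => (hv i).1
    have hsub : ∀ x : ↥(K n ∩ (H : Set G)),
        φ.eval (fun n => K n ∩ (H : Set G)) (Fin.cons (α := fun _ => G) (x : G) v) =
          φ.eval K (Fin.cons (α := fun _ => G) (x : G) v) := fun x =>
      ih _ fun i => cons_mem_pi (S := fun n => K n ∩ (H : Set G)) x.2 (fun j _ => hv j) i trivial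
    simp only [GroupFormula.eval, hsub]
    exact ciInf_subtype_eq_of_forall_exists_lt inter_subset_left
      (f := fun x => φ.eval K (Fin.cons (α := fun _ => G) x v))
      (φ.bddBelow_range_eval hK hvK subset_rfl) (key φ hv)

/-! ### Failure of property FR for the subgroup -/

lemma InducesGRStructure.subgroup {G : Type*} [Group G] [MetricSpace G] {K : ℕ → Set G}
    {ν : ℕ → ℕ → ℕ} {F : ℕ → ℕ → ContModulus} {T : Type*} [MetricSpace T] [MulAction G T]
    [IsIsometricSMul G T] {o : T} (hT : InducesGRStructure K ν F T o) (H : Subgroup G)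
    [IsIsometricSMul H T] :
    InducesGRStructure (fun n => ((↑) : H → G) ⁻¹' K n) ν F T o where
  tree := hT.tree
  complete := hT.complete
  mapsTo n m g hg x hx := hT.mapsTo n m g hg x hx
  modulus n m ε hε :=
    ⟨fun g hg g' hg' x hx h => (hT.modulus n m ε hε).1 g hg g' hg' x hx h,
      fun g hg x hx x' hx' h => (hT.modulus n m ε hε).2 g hg x hx x' hx' h⟩

theorem mainTheorem8 {G : Type u} [Group G] [MetricSpace G] [IsTopologicalGroup G]
    (F₀ : ℕ → ContModulus) (K : ℕ → Set G) (hK : IsContinuousPresentation F₀ K)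
    (ν : ℕ → ℕ → ℕ) (hν : IncreasingInEach ν) (F : ℕ → ℕ → ContModulus)
    (T : Type v) [MetricSpace T] [MulAction G T] [IsIsometricSMul G T] (o : T)
    (hT : InducesGRStructure K ν F T o)
    (hfix : ∀ x : T, ∃ g : G, g • x ≠ x)
    (C : Set G) (hC : C.Infinite) :
    ∃ H : Subgroup G,
      C ⊆ (H : Set G) ∧
      IsClosed (H : Set G) ∧
      IsContinuouslyElementary K H ∧
      densityCharacter H = densityCharacter C ∧
      ¬ PropertyFR.{u, v} (fun n => ((↑) : H → G) ⁻¹' K n) F := by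
  have : Infinite C := hC.to_subtype
  have hκ := aleph0_le_densityCharacter C
  obtain ⟨D, hDc, hD⟩ := exists_countable_forall_exists_smul_ne hT.tree hT.complete hfix
  obtain ⟨s, hs, hsC⟩ := exists_dense_mk_eq_densityCharacter C
  have hA : Cardinal.mk ↥(((↑) : C → G) '' s ∪ D) ≤ densityCharacter C :=
    (Cardinal.mk_union_le _ _).trans (Cardinal.add_le_of_le hκ
      (Cardinal.mk_image_le.trans hsC.le) ((Cardinal.le_aleph0_iff_set_countable.2 hDc).trans hκ))
  obtain ⟨B, hAB, hB, hnear, hform⟩ := exists_subgroup_closed_under_witnesses K _ hκ hA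
  have hBH : B ≤ B.topologicalClosure := B.le_topologicalClosure
  have hCH : C ⊆ (B.topologicalClosure : Set G) :=
    (Subtype.dense_iff.1 hs).trans (closure_mono (subset_union_left.trans hAB))
  refine ⟨B.topologicalClosure, hCH, B.isClosed_topologicalClosure,
    isContinuouslyElementary_topologicalClosure hK hnear hform, le_antisymm ?_ ?_, fun hFR => ?_⟩
  · have hd : Dense (((↑) : B.topologicalClosure → G) ⁻¹' (B : Set G)) := by
      exact Subtype.dense_iff.2 (closure_mono fun b hb => ⟨⟨b, hBH hb⟩, hb, rfl⟩)
    exact (densityCharacter_le_mk hd).trans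
      ((Cardinal.mk_preimage_of_injective _ _ Subtype.val_injective).trans hB)
  · have : Infinite B.topologicalClosure := (hC.mono hCH).to_subtype
    exact Isometry.densityCharacter_le (f := inclusion hCH) (fun _ _ => rfl)
      (aleph0_le_densityCharacter _)
  · have : IsIsometricSMul B.topologicalClosure T := ⟨fun g => isometry_smul T (g : G)⟩
    obtain ⟨x, hx⟩ := hFR ν hν T o (hT.subgroup _)
    obtain ⟨g, hgD, hg⟩ := hD x
    exact hg (hx ⟨g, hBH (hAB (Or.inr hgD))⟩)
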